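/- Let $d\ge 1$, let $\mathbb{T}^d=\mathbb{R}^d/\mathbb{Z}^d$ be the unit torus, and let $\mathcal{Y}^d=[0,1)^d$. Let $V:\mathbb{T}^d\times\mathbb{R}^d\to\mathbb{R}$, $(x,y)\mapsto V(x,y)$, be a smooth function that is $\mathcal{Y}^d$-periodic in $y$ (that is, $1$-periodic in each coordinate of $y$). If $d>1$, assume further that $V$ is separable in $y$: there are smooth functions $V_i:\mathbb{T}^d\times\mathbb{R}\to\mathbb{R}$, $1\le i\le d$, with $$V(x,y)=\sum_{i=1}^d V_i(x,y_i)\qquad\text{for all } x\in\mathbb{T}^d,\ y\in\mathbb{R}^d .$$ Let $\alpha\in(0,1)$ and suppose that, for every $x\in\mathbb{T}^d$ and $\Lambda\in\mathbb{R}^d$, the $\mathcal{Y}^d$-periodic functions $\widetilde w(x,\Lambda,\cdot)\in C^{2,\alpha}(\mathbb{R}^d)$ (determined up to an additive constant) and $\widetilde m(x,\Lambda,\cdot)\in C^{1,\alpha}(\mathbb{R}^d)$, $\widetilde m>0$, and the number $\widetilde H(x,\Lambda)\in\mathbb{R}$ solve the cell problem $$\begin{cases} \dfrac{|\Lambda+\nabla_y\widetilde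 w(x,\Lambda,y)|^2}{2}+V(x,y)=\ln\widetilde m(x,\Lambda,y)+\widetilde H(x,\Lambda), & y\in\mathcal{Y}^d,\\[1ex] -\operatorname{div}_y\big(\widetilde m(x,\Lambda,y)\,(\Lambda+\nabla_y\widetilde w(x,\Lambda,y))\big)=0, & y\in\mathcal{Y}^d,\\[1ex] \displaystyle\int_{\mathcal{Y}^d}\widetilde m(x,\Lambda,y)\,dy=1. & \end{cases}$$ Then, for every $x\in\mathbb{T}^d$, the function $\Lambda\mapsto\widetilde H(x,\Lambda)$ is twice continuously differentiable, and $\widetilde H$ is uniformly convex in $\Lambda$: there exists a constant $C>0$, independent of $x$, $\Lambda$ and $\xi$, such that $$\sum_{j,l=1}^d \xi_j\,\frac{\partial^2\widetilde H}{\partial\Lambda_j\,\partial\Lambda_l}(x,\Lambda)\,\xi_l\ \ge\ C\,|\xi|^2\qquad\text{for all } x\in\mathbb{T}^d,\ \Lambda\in\mathbb{R}^d,\ \xi\in\mathbb{R}^d .$$ -/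

import Mathlib

open scoped NNReal ContDiff

noncomputable section

namespace CellProblem

/-- `ℝ^d` with the Euclidean norm. -/
abbrev E (d : ℕ) : Type := EuclideanSpace ℝ (Fin d)

/-- The `i`-th vector of the canonical basis of `ℝ^d`. -/
def e {d : ℕ} (i : Fin d) : E d := EuclideanSpace.single i (1 : ℝ)

/-- The unit cell `[0,1)^d`. -/
def unitCell (d : ℕ) : Set (E d) := {y | ∀ i, y i ∈ Set.Ico (0 : ℝ) 1}

/-- `f` is `1`-periodic in each coordinate; such functions are the functions on the unit torus
`ℝ^d / ℤ^d`. -/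
def CellPeriodic {d : ℕ} {X : Type*} (f : E d → X) : Prop :=
  ∀ i : Fin d, Function.Periodic f (e i)

/-- `f` belongs to the space of periodic `C^{k,α}` functions on the unit cell. (The derivatives
of order at most `k` are bounded, by continuity and periodicity.) -/
def PeriodicHolder {d : ℕ} (k : ℕ) (α : ℝ≥0) (f : E d → ℝ) : Prop :=
  CellPeriodic f ∧ ContDiff ℝ k f ∧ ∃ K : ℝ≥0, HolderWith K α (iteratedFDeriv ℝ k f)

/-- Divergence of a vector field on `ℝ^d`: the sum over `i` of `∂_i F_i`. -/
def divergence {d : ℕ} (F : E d → E d) (y : E d) : ℝ :=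
  ∑ i : Fin d, fderiv ℝ (fun z => F z i) y (e i)

/-- An admissible potential: `V : T^d × ℝ^d → ℝ` is smooth and periodic in the second variable
(functions of `x` on the torus `T^d` are identified with periodic functions on `ℝ^d`). -/
structure IsPotential {d : ℕ} (V : E d → E d → ℝ) : Prop where
  smooth : ContDiff ℝ ∞ (fun p : E d × E d => V p.1 p.2)
  periodic_x : CellPeriodic V
  periodic_y : ∀ x, CellPeriodic (V x)

/-- `V` is separable in `y`: `V(x,y) = ∑ i, V_i(x, y_i)` with smooth `V_i : T^d × ℝ → ℝ`. -/
def IsSeparable {d : ℕ} (V : E d → E d → ℝ) : Prop :=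
  ∃ W : Fin d → E d → ℝ → ℝ,
    (∀ i, ContDiff ℝ ∞ (fun p : E d × ℝ => W i p.1 p.2)) ∧
    (∀ i, CellPeriodic (W i)) ∧
    ∀ x y, V x y = ∑ i : Fin d, W i x (y i)

/-- `(w, m, h)` is a solution of the cell problem with potential `v = V(x, ·)` and vector `Λ`, in
the class `w ∈ C^{2,α}`, `m ∈ C^{1,α}` of periodic functions, with `m > 0`.
The function `w` stands for its class modulo additive constants. -/
structure IsCellSolution {d : ℕ} (α : ℝ≥0) (v : E d → ℝ) (Λ : E d)
    (w m : E d → ℝ) (h : ℝ) : Prop where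
  w_holder : PeriodicHolder 2 α w
  m_holder : PeriodicHolder 1 α m
  m_pos : ∀ y, 0 < m y
  hamiltonJacobi : ∀ y, ‖Λ + gradient w y‖ ^ 2 / 2 + v y = Real.log (m y) + h
  transport : ∀ y, -divergence (fun z => m z • (Λ + gradient w z)) y = 0
  mass : ∫ y in unitCell d, m y = 1

/-- The second partial derivative `∂²f / ∂Λ_j ∂Λ_l` at `Λ`. -/
def secondPartial {d : ℕ} (f : E d → ℝ) (Λ : E d) (j l : Fin d) : ℝ :=
  iteratedFDeriv ℝ 2 f Λ ![e j, e l]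

end CellProblem

end

/-!
For fixed `x` and `Λ` the number `H` is unique: since `q ↦ exp (|q|² / 2 + v)` is convex and the
flux `m (Λ + ∇w)` is divergence free, a solution satisfies
`exp H = min_u ∫ exp (|Λ + ∇u|² / 2 + v)`, the minimum being over periodic `u`. A separable
potential therefore has `H(Λ) = v 0 + ∑ h_i(Λ_i)`, because sums of one-dimensional `w`'s and
products of one-dimensional `m`'s solve the cell problem.

In dimension one the flux `c = m p`, with `p = L + w'`, is constant, so `p e^{p²/2 + v}` is a
constant `k = c e^h` and `p` is the inverse function of `p ↦ p e^{p²/2}` at `k e^{-v}`. The mean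
`L = ∫ p` is an increasing function of `k`, and `h = log Z` for `Z = ∫ e^{p²/2 + v}`.
Differentiating, `h' = k / Z = c` and `h'' = 1 / (Z ∂L/∂k) - c²`. Since `m² (1 + p²) = m² + c²`,
one has `Z ∂p/∂k = 1 / (m (1 + p²)) = m / (m² + c²)`, hence `h'' ≥ (inf m)²`. Finally `m` varies by
a factor of at most `e^R`, `R` the oscillation of `v`, because `m` larger forces `p²` smaller; as
`∫ m = 1`, `inf m ≥ e^{-R}`.
-/

namespace CellProblem

open Filter Topology MeasureTheory Set Function

noncomputable section

/-! ### Calculus on the line -/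

theorem contDiff_one_of_hasDerivAt {f f' : ℝ → ℝ} (hf : ∀ t, HasDerivAt f (f' t) t)
    (hf' : Continuous f') : ContDiff ℝ 1 f := by
  rw [contDiff_one_iff_deriv, deriv_eq hf]
  exact ⟨fun t => (hf t).differentiableAt, hf'⟩

theorem contDiff_two_of_hasDerivAt {f f' f'' : ℝ → ℝ} (hf : ∀ t, HasDerivAt f (f' t) t)
    (hf' : ∀ t, HasDerivAt f' (f'' t) t) (hf'' : Continuous f'') : ContDiff ℝ 2 f := by
  rw [← one_add_one_eq_two, contDiff_succ_iff_deriv, deriv_eq hf]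
  exact ⟨fun t => (hf t).differentiableAt, by simp, contDiff_one_of_hasDerivAt hf' hf''⟩

/-- A function with positive derivative and infinite limits `±∞` at `±∞`, as an order isomorphism
of the line; this names the inverse functions of the one-dimensional problem. -/
def orderIsoOfDerivPos {f f' : ℝ → ℝ} (hf : ∀ t, HasDerivAt f (f' t) t) (hpos : ∀ t, 0 < f' t)
    (htop : Tendsto f atTop atTop) (hbot : Tendsto f atBot atBot) : ℝ ≃o ℝ :=
  StrictMono.orderIsoOfSurjective f
    (strictMono_of_deriv_pos fun t => (hf t).deriv.symm ▸ hpos t)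
    (Continuous.surjective (continuous_iff_continuousAt.2 fun t => (hf t).continuousAt) htop hbot)

theorem hasDerivAt_orderIso_symm {φ : ℝ ≃o ℝ} {φ' s : ℝ} (hφ : HasDerivAt φ φ' (φ.symm s))
    (hφ' : φ' ≠ 0) : HasDerivAt φ.symm φ'⁻¹ s :=
  hφ.of_local_left_inverse φ.symm.continuous.continuousAt hφ'
    (Eventually.of_forall φ.apply_symm_apply)

theorem hasDerivAt_intervalIntegral_of_continuous {G : Type*} [NormedAddCommGroup G]
    [NormedSpace ℝ G] {F F' : ℝ → ℝ → G} (hF : ∀ k, Continuous (F k))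
    (hF' : Continuous (uncurry F')) (hderiv : ∀ k t, HasDerivAt (fun k => F k t) (F' k t) k)
    (a b k : ℝ) : HasDerivAt (fun k => ∫ t in a..b, F k t) (∫ t in a..b, F' k t) k := by
  obtain ⟨B, hB⟩ := ((isCompact_closedBall k 1).prod (isCompact_uIcc (a := a) (b := b)))
    |>.exists_bound_of_continuousOn hF'.continuousOn
  exact (intervalIntegral.hasDerivAt_integral_of_dominated_loc_of_deriv_le
    (bound := fun _ => B) (Metric.closedBall_mem_nhds k one_pos)
    (Eventually.of_forall fun k => (hF k).aestronglyMeasurable)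
    ((hF k).intervalIntegrable a b) (hF'.uncurry_left k).aestronglyMeasurable
    (Eventually.of_forall fun t ht r hr => hB (r, t) ⟨hr, uIoc_subset_uIcc ht⟩)
    intervalIntegrable_const (Eventually.of_forall fun t _ r _ => hderiv r t)).2

theorem exists_periodic_primitive {p : ℝ → ℝ} (hp : Continuous p) (hper : Periodic p 1) :
    ∃ φ : ℝ → ℝ, ContDiff ℝ 1 φ ∧ Periodic φ 1 ∧
      ∀ t, HasDerivAt φ (p t - ∫ s in (0 : ℝ)..1, p s) t := by
  set q : ℝ → ℝ := fun t => p t - ∫ s in (0 : ℝ)..1, p s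
  have hq : Continuous q := hp.sub continuous_const
  have hderiv : ∀ t, HasDerivAt (fun t => ∫ s in (0 : ℝ)..t, q s) (q t) t := fun t =>
    hq.integral_hasStrictDerivAt 0 t |>.hasDerivAt
  refine ⟨_, contDiff_one_of_hasDerivAt hderiv hq, fun t => ?_, hderiv⟩
  have hqper : Periodic q 1 := fun t => by simp only [q, hper t]
  have hqmean : ∫ s in (0 : ℝ)..1, q s = 0 := by
    simp [q, intervalIntegral.integral_sub (hp.intervalIntegrable 0 1) intervalIntegrable_const]
  have hstep : ∫ s in t..t + 1, q s = 0 := by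
    rw [hqper.intervalIntegral_add_eq t 0, zero_add, hqmean]
  beta_reduce
  rw [← intervalIntegral.integral_add_adjacent_intervals (hq.intervalIntegrable 0 t)
    (hq.intervalIntegrable t (t + 1)), hstep, add_zero]

/-! ### The one-dimensional problem -/

theorem hasDerivAt_mul_exp_sq (p : ℝ) :
    HasDerivAt (fun p : ℝ => p * Real.exp (p ^ 2 / 2)) ((1 + p ^ 2) * Real.exp (p ^ 2 / 2)) p := by
  have hsq : HasDerivAt (fun p : ℝ => p ^ 2 / 2) p p := by
    simpa using ((hasDerivAt_id p).pow 2).div_const 2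
  exact ((hasDerivAt_id p).mul hsq.exp).congr_deriv (by simp only [id]; ring)

theorem tendsto_mul_exp_sq_atTop : Tendsto (fun p : ℝ => p * Real.exp (p ^ 2 / 2)) atTop atTop := by
  refine tendsto_atTop_mono' _ ?_ tendsto_id
  filter_upwards [eventually_ge_atTop 0] with p hp
  exact le_mul_of_one_le_right hp (Real.one_le_exp (by positivity))

theorem tendsto_mul_exp_sq_atBot : Tendsto (fun p : ℝ => p * Real.exp (p ^ 2 / 2)) atBot atBot := by
  simpa [comp_def] using
    tendsto_neg_atTop_atBot.comp (tendsto_mul_exp_sq_atTop.comp tendsto_neg_atBot_atTop)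

/-- The order isomorphism `p ↦ p * exp (p ^ 2 / 2)` of the line; its inverse expresses the momentum
of the one-dimensional problem. -/
def mulExpSq : ℝ ≃o ℝ :=
  orderIsoOfDerivPos hasDerivAt_mul_exp_sq (fun p => by positivity) tendsto_mul_exp_sq_atTop
    tendsto_mul_exp_sq_atBot

theorem mulExpSq_apply (p : ℝ) : mulExpSq p = p * Real.exp (p ^ 2 / 2) := rfl

theorem mulExpSq_symm_neg (s : ℝ) : mulExpSq.symm (-s) = -mulExpSq.symm s := by
  rw [OrderIso.symm_apply_eq, mulExpSq_apply, neg_sq, neg_mul, ← mulExpSq_apply,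
    OrderIso.apply_symm_apply]

theorem hasDerivAt_mulExpSq_symm (s : ℝ) : HasDerivAt mulExpSq.symm
    ((1 + mulExpSq.symm s ^ 2) * Real.exp (mulExpSq.symm s ^ 2 / 2))⁻¹ s :=
  hasDerivAt_orderIso_symm (hasDerivAt_mul_exp_sq _) (by positivity)

theorem contDiff_mulExpSq_symm : ContDiff ℝ 1 mulExpSq.symm := by
  have := mulExpSq.symm.continuous
  exact contDiff_one_of_hasDerivAt hasDerivAt_mulExpSq_symm
    (Continuous.inv₀ (by fun_prop) fun s => by positivity)

/-- The total momentum `p = L + w'` of the one-dimensional problem with potential `v`, as a function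
of the constant `k = p * exp (p ^ 2 / 2 + v)`. -/
def momentum (v : ℝ → ℝ) (k t : ℝ) : ℝ := mulExpSq.symm (k * Real.exp (-v t))

/-- The density of the one-dimensional problem before normalization. -/
def gibbsWeight (v : ℝ → ℝ) (k t : ℝ) : ℝ := Real.exp (momentum v k t ^ 2 / 2 + v t)

/-- The derivative of `momentum v k t` in `k`. -/
def momentumDeriv (v : ℝ → ℝ) (k t : ℝ) : ℝ := ((1 + momentum v k t ^ 2) * gibbsWeight v k t)⁻¹

/-- The mean of the momentum over a period, that is, the parameter `L` of the one-dimensional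
problem as a function of `k`. -/
def meanMomentum (v : ℝ → ℝ) (k : ℝ) : ℝ := ∫ t in (0 : ℝ)..1, momentum v k t

/-- The derivative of `meanMomentum v`. -/
def meanMomentumDeriv (v : ℝ → ℝ) (k : ℝ) : ℝ := ∫ t in (0 : ℝ)..1, momentumDeriv v k t

/-- The normalizing constant of the density. -/
def partitionFn (v : ℝ → ℝ) (k : ℝ) : ℝ := ∫ t in (0 : ℝ)..1, gibbsWeight v k t

/-- The probability density `m` of the one-dimensional problem. -/
def density (v : ℝ → ℝ) (k t : ℝ) : ℝ := gibbsWeight v k t / partitionFn v k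

section Pointwise

variable (v : ℝ → ℝ) (k t : ℝ)

theorem gibbsWeight_pos : 0 < gibbsWeight v k t := Real.exp_pos _

theorem momentumDeriv_pos : 0 < momentumDeriv v k t := by
  have := gibbsWeight_pos v k t
  exact inv_pos.2 (by positivity)

theorem momentum_neg : momentum v (-k) t = -momentum v k t := by
  rw [momentum, neg_mul, mulExpSq_symm_neg, momentum]

theorem meanMomentum_neg : meanMomentum v (-k) = -meanMomentum v k := by
  simp only [meanMomentum, momentum_neg, intervalIntegral.integral_neg]

theorem momentum_mul_gibbsWeight : momentum v k t * gibbsWeight v k t = k := by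
  rw [gibbsWeight, Real.exp_add, ← mul_assoc, ← mulExpSq_apply, momentum,
    OrderIso.apply_symm_apply, mul_assoc, ← Real.exp_add, neg_add_cancel, Real.exp_zero, mul_one]

theorem density_mul_momentum : density v k t * momentum v k t = k / partitionFn v k := by
  rw [density, div_mul_eq_mul_div, mul_comm, momentum_mul_gibbsWeight]

theorem hasDerivAt_momentum : HasDerivAt (fun k => momentum v k t) (momentumDeriv v k t) k := by
  refine ((hasDerivAt_mulExpSq_symm _).comp k
    ((hasDerivAt_id k).mul_const (Real.exp (-v t)))).congr_deriv ?_
  rw [one_mul, Real.exp_neg, ← mul_inv, mul_assoc, ← Real.exp_add]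
  simp only [momentumDeriv, gibbsWeight, momentum, Real.exp_neg, id]

theorem hasDerivAt_gibbsWeight :
    HasDerivAt (fun k => gibbsWeight v k t) (k * momentumDeriv v k t) k := by
  refine ((((hasDerivAt_momentum v k t).fun_pow 2).div_const 2).add_const (v t)).exp.congr_deriv ?_
  rw [← gibbsWeight]
  nth_rw 4 [← momentum_mul_gibbsWeight v k t]
  push_cast
  ring

end Pointwise

section Continuous

variable {v : ℝ → ℝ} (hv : Continuous v)
include hv

theorem continuous_momentum : Continuous (uncurry (momentum v)) :=
  mulExpSq.symm.continuous.comp (by fun_prop)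

theorem continuous_gibbsWeight : Continuous (uncurry (gibbsWeight v)) := by
  have hp := continuous_momentum hv
  exact Real.continuous_exp.comp (((hp.pow 2).div_const 2).add (hv.comp continuous_snd))

theorem continuous_momentumDeriv : Continuous (uncurry (momentumDeriv v)) := by
  refine ((continuous_const.add ((continuous_momentum hv).pow 2)).mul
    (continuous_gibbsWeight hv)).inv₀ fun q => ?_
  have hg := gibbsWeight_pos v q.1 q.2
  change (1 + momentum v q.1 q.2 ^ 2) * gibbsWeight v q.1 q.2 ≠ 0
  positivity

theorem continuous_density (k : ℝ) : Continuous (density v k) :=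
  ((continuous_gibbsWeight hv).uncurry_left k).div_const _

theorem hasDerivAt_meanMomentum (k : ℝ) : HasDerivAt (meanMomentum v) (meanMomentumDeriv v k) k :=
  hasDerivAt_intervalIntegral_of_continuous (continuous_momentum hv).uncurry_left
    (continuous_momentumDeriv hv) (hasDerivAt_momentum v) 0 1 k

theorem hasDerivAt_partitionFn (k : ℝ) :
    HasDerivAt (partitionFn v) (k * meanMomentumDeriv v k) k := by
  rw [meanMomentumDeriv, ← intervalIntegral.integral_const_mul]
  exact hasDerivAt_intervalIntegral_of_continuous (F' := fun k t => k * momentumDeriv v k t)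
    (continuous_gibbsWeight hv).uncurry_left
    (continuous_fst.mul (continuous_momentumDeriv hv)) (hasDerivAt_gibbsWeight v) 0 1 k

theorem continuous_meanMomentumDeriv : Continuous (meanMomentumDeriv v) :=
  intervalIntegral.continuous_parametric_intervalIntegral_of_continuous'
    (continuous_momentumDeriv hv) 0 1

theorem meanMomentumDeriv_pos (k : ℝ) : 0 < meanMomentumDeriv v k :=
  intervalIntegral.intervalIntegral_pos_of_pos
    (((continuous_momentumDeriv hv).uncurry_left k).intervalIntegrable 0 1)
    (momentumDeriv_pos v k) one_pos

theorem partitionFn_pos (k : ℝ) : 0 < partitionFn v k :=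
  intervalIntegral.intervalIntegral_pos_of_pos
    (((continuous_gibbsWeight hv).uncurry_left k).intervalIntegrable 0 1)
    (gibbsWeight_pos v k) one_pos

theorem density_pos (k t : ℝ) : 0 < density v k t :=
  div_pos (gibbsWeight_pos v k t) (partitionFn_pos hv k)

theorem integral_density (k : ℝ) : ∫ t in (0 : ℝ)..1, density v k t = 1 := by
  simp only [density, intervalIntegral.integral_div]
  exact div_self (partitionFn_pos hv k).ne'

theorem tendsto_meanMomentum_atTop : Tendsto (meanMomentum v) atTop atTop := by
  obtain ⟨B, hB⟩ := (isCompact_Icc (a := (0 : ℝ)) (b := 1)).bddAbove_image hv.continuousOn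
  have hlower : Tendsto (fun k => mulExpSq.symm (k * Real.exp (-B))) atTop atTop :=
    mulExpSq.symm.tendsto_atTop.comp (tendsto_id.atTop_mul_const (Real.exp_pos _))
  refine tendsto_atTop_mono' _ ?_ hlower
  filter_upwards [eventually_ge_atTop 0] with k hk
  have hp : ∀ t ∈ Icc (0 : ℝ) 1, mulExpSq.symm (k * Real.exp (-B)) ≤ momentum v k t :=
    fun t ht => by
      have hvt : v t ≤ B := hB (mem_image_of_mem v ht)
      exact mulExpSq.symm.monotone (by gcongr)
  simpa [meanMomentum] using intervalIntegral.integral_mono_on (μ := volume) zero_le_one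
    intervalIntegrable_const (((continuous_momentum hv).uncurry_left k).intervalIntegrable 0 1) hp

theorem tendsto_meanMomentum_atBot : Tendsto (meanMomentum v) atBot atBot := by
  simpa [comp_def, meanMomentum_neg] using
    tendsto_neg_atTop_atBot.comp ((tendsto_meanMomentum_atTop hv).comp tendsto_neg_atBot_atTop)

theorem density_le_exp_mul_density (k : ℝ) {R s t : ℝ} (hR : 0 ≤ R) (hst : v s - v t ≤ R) :
    density v k s ≤ Real.exp R * density v k t := by
  have hs := density_pos hv k s
  have ht := density_pos hv k t
  rcases le_total (density v k s) (density v k t) with hle | hle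
  · exact hle.trans (le_mul_of_one_le_left ht.le (Real.one_le_exp hR))
  -- The flux is the same at `s` and `t`, so the larger density has the smaller momentum.
  · have hflux : (density v k s * momentum v k s) ^ 2 = (density v k t * momentum v k t) ^ 2 := by
      rw [density_mul_momentum, density_mul_momentum]
    have hp : momentum v k s ^ 2 ≤ momentum v k t ^ 2 := by
      refine le_of_mul_le_mul_left ?_ (pow_pos hs 2)
      rw [← mul_pow, hflux, mul_pow]
      gcongr
    rw [density, density, ← mul_div_assoc, gibbsWeight, gibbsWeight, ← Real.exp_add]
    have := partitionFn_pos hv k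
    refine div_le_div_of_nonneg_right (Real.exp_le_exp.2 ?_) this.le
    linarith

theorem exp_neg_le_density (k t : ℝ) {R : ℝ} (hR : ∀ s t, v s - v t ≤ R) :
    Real.exp (-R) ≤ density v k t := by
  have hR0 : 0 ≤ R := by simpa using hR t t
  have hint : ∫ s in (0 : ℝ)..1, density v k s ≤ ∫ _ in (0 : ℝ)..1, Real.exp R * density v k t :=
    intervalIntegral.integral_mono_on (μ := volume) zero_le_one
      ((continuous_density hv k).intervalIntegrable 0 1) intervalIntegrable_const
      fun s _ => density_le_exp_mul_density hv k hR0 (hR s t)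
  rw [integral_density hv, intervalIntegral.integral_const, sub_zero, one_smul] at hint
  rwa [Real.exp_neg, inv_le_iff_one_le_mul₀' (Real.exp_pos R)]

theorem partitionFn_mul_momentumDeriv (k t : ℝ) : partitionFn v k * momentumDeriv v k t =
    density v k t / (density v k t ^ 2 + (k / partitionFn v k) ^ 2) := by
  have hZ := partitionFn_pos hv k
  have hg := gibbsWeight_pos v k t
  rw [← density_mul_momentum v k t, density, momentumDeriv]
  field_simp

theorem exp_neg_sq_add_mul_le_one (k : ℝ) {R : ℝ} (hR : ∀ s t, v s - v t ≤ R) :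
    (Real.exp (-R) ^ 2 + (k / partitionFn v k) ^ 2) *
      (partitionFn v k * meanMomentumDeriv v k) ≤ 1 := by
  rw [meanMomentumDeriv, ← intervalIntegral.integral_const_mul,
    ← intervalIntegral.integral_const_mul]
  refine le_of_le_of_eq ?_ (integral_density hv k)
  refine intervalIntegral.integral_mono_on (μ := volume) zero_le_one
    (((continuous_momentumDeriv hv).uncurry_left k).const_mul _ |>.const_mul _
      |>.intervalIntegrable 0 1) ((continuous_density hv k).intervalIntegrable 0 1) fun t _ => ?_
  have hm := density_pos hv k t
  have hlow := exp_neg_le_density hv k t hR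
  rw [partitionFn_mul_momentumDeriv hv, mul_div_left_comm]
  refine mul_le_of_le_one_right hm.le (div_le_one_of_le₀ ?_ (by positivity))
  gcongr

/-- `meanMomentum v` as an order isomorphism; its inverse recovers the parameter `k` from `L`. -/
def meanMomentumIso : ℝ ≃o ℝ :=
  orderIsoOfDerivPos (hasDerivAt_meanMomentum hv) (meanMomentumDeriv_pos hv)
    (tendsto_meanMomentum_atTop hv) (tendsto_meanMomentum_atBot hv)

/-- The effective Hamiltonian `h(L)` of the one-dimensional problem. -/
def effectiveHamiltonian (L : ℝ) : ℝ := Real.log (partitionFn v ((meanMomentumIso hv).symm L))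

/-- The constant flux `c = m (L + w')` of the one-dimensional problem; it is the derivative of
`effectiveHamiltonian`. -/
def flux (L : ℝ) : ℝ := (meanMomentumIso hv).symm L / partitionFn v ((meanMomentumIso hv).symm L)

/-- The derivative of `flux`. -/
def fluxDeriv (L : ℝ) : ℝ :=
  (partitionFn v ((meanMomentumIso hv).symm L) *
    meanMomentumDeriv v ((meanMomentumIso hv).symm L))⁻¹ - flux hv L ^ 2

theorem meanMomentum_meanMomentumIso_symm (L : ℝ) :
    meanMomentum v ((meanMomentumIso hv).symm L) = L :=
  (meanMomentumIso hv).apply_symm_apply L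

theorem hasDerivAt_meanMomentumIso_symm (L : ℝ) : HasDerivAt (meanMomentumIso hv).symm
    (meanMomentumDeriv v ((meanMomentumIso hv).symm L))⁻¹ L :=
  hasDerivAt_orderIso_symm (hasDerivAt_meanMomentum hv _) (meanMomentumDeriv_pos hv _).ne'

theorem hasDerivAt_partitionFn_comp_symm (L : ℝ) :
    HasDerivAt (fun L => partitionFn v ((meanMomentumIso hv).symm L))
      ((meanMomentumIso hv).symm L) L :=
  ((hasDerivAt_partitionFn hv _).comp L (hasDerivAt_meanMomentumIso_symm hv L)).congr_deriv
    (mul_inv_cancel_right₀ (meanMomentumDeriv_pos hv _).ne' _)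

theorem hasDerivAt_effectiveHamiltonian (L : ℝ) :
    HasDerivAt (effectiveHamiltonian hv) (flux hv L) L :=
  (hasDerivAt_partitionFn_comp_symm hv L).log (partitionFn_pos hv _).ne'

theorem hasDerivAt_flux (L : ℝ) : HasDerivAt (flux hv) (fluxDeriv hv L) L := by
  have hZ := (partitionFn_pos hv ((meanMomentumIso hv).symm L)).ne'
  have hD := (meanMomentumDeriv_pos hv ((meanMomentumIso hv).symm L)).ne'
  refine ((hasDerivAt_meanMomentumIso_symm hv L).div
    (hasDerivAt_partitionFn_comp_symm hv L) hZ).congr_deriv ?_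
  rw [fluxDeriv, flux]
  field_simp

theorem continuous_fluxDeriv : Continuous (fluxDeriv hv) := by
  have hk := (meanMomentumIso hv).symm.continuous
  have hZ : Continuous fun L => partitionFn v ((meanMomentumIso hv).symm L) :=
    continuous_iff_continuousAt.2 fun L => (hasDerivAt_partitionFn_comp_symm hv L).continuousAt
  have hflux : Continuous (flux hv) :=
    continuous_iff_continuousAt.2 fun L => (hasDerivAt_flux hv L).continuousAt
  exact ((hZ.mul ((continuous_meanMomentumDeriv hv).comp hk)).inv₀ fun L =>
    (mul_pos (partitionFn_pos hv _) (meanMomentumDeriv_pos hv _)).ne').sub (hflux.pow 2)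

theorem contDiff_effectiveHamiltonian : ContDiff ℝ 2 (effectiveHamiltonian hv) :=
  contDiff_two_of_hasDerivAt (hasDerivAt_effectiveHamiltonian hv) (hasDerivAt_flux hv)
    (continuous_fluxDeriv hv)

theorem exp_neg_sq_le_fluxDeriv {R : ℝ} (hR : ∀ s t, v s - v t ≤ R) (L : ℝ) :
    Real.exp (-R) ^ 2 ≤ fluxDeriv hv L := by
  set k := (meanMomentumIso hv).symm L
  have hpos : 0 < partitionFn v k * meanMomentumDeriv v k :=
    mul_pos (partitionFn_pos hv k) (meanMomentumDeriv_pos hv k)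
  rw [fluxDeriv, le_sub_iff_add_le, ← one_div, le_div_iff₀ hpos]
  exact exp_neg_sq_add_mul_le_one hv k hR

end Continuous

/-- The one-dimensional cell problem with potential `v` and parameter `L`, written in terms of the
total momentum `p = L + w'`, the density `μ`, the constant flux `c` and the effective value `h`. -/
structure IsMomentumSolution (v : ℝ → ℝ) (L : ℝ) (p μ : ℝ → ℝ) (c h : ℝ) : Prop where
  contDiff_momentum : ContDiff ℝ 1 p
  periodic_momentum : Periodic p 1
  mean_momentum : ∫ t in (0 : ℝ)..1, p t = L
  contDiff_density : ContDiff ℝ 1 μ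
  periodic_density : Periodic μ 1
  density_pos : ∀ t, 0 < μ t
  mass : ∫ t in (0 : ℝ)..1, μ t = 1
  flux : ∀ t, μ t * p t = c
  hamiltonJacobi : ∀ t, p t ^ 2 / 2 + v t = Real.log (μ t) + h

theorem isMomentumSolution_effectiveHamiltonian {v : ℝ → ℝ} (hv : ContDiff ℝ 1 v)
    (hper : Periodic v 1) (L : ℝ) :
    IsMomentumSolution v L (momentum v ((meanMomentumIso hv.continuous).symm L))
      (density v ((meanMomentumIso hv.continuous).symm L)) (flux hv.continuous L)
      (effectiveHamiltonian hv.continuous L) := by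
  set k := (meanMomentumIso hv.continuous).symm L
  have hp : ContDiff ℝ 1 (momentum v k) :=
    contDiff_mulExpSq_symm.comp (contDiff_const.mul hv.neg.exp)
  have hpp : Periodic (momentum v k) 1 := fun t => by simp only [momentum, hper t]
  exact
    { contDiff_momentum := hp
      periodic_momentum := hpp
      mean_momentum := meanMomentum_meanMomentumIso_symm hv.continuous L
      contDiff_density := (((hp.pow 2).div_const 2).add hv).exp.div_const _
      periodic_density := fun t => by simp only [density, gibbsWeight, hpp t, hper t]
      density_pos := density_pos hv.continuous k
      mass := integral_density hv.continuous k
      flux := density_mul_momentum v k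
      hamiltonJacobi := fun t => by
        rw [density, Real.log_div (gibbsWeight_pos v k t).ne' (partitionFn_pos hv.continuous k).ne',
          gibbsWeight, Real.log_exp, effectiveHamiltonian, sub_add_cancel] }

/-! ### Periodic functions and integration over the unit cell -/

theorem contDiff_gradient {F : Type*} [NormedAddCommGroup F] [InnerProductSpace ℝ F]
    [CompleteSpace F] {u : F → ℝ} {n N : WithTop ℕ∞} (hu : ContDiff ℝ N u) (hn : n + 1 ≤ N) :
    ContDiff ℝ n (gradient u) :=
  (InnerProductSpace.toDual ℝ F).symm.contDiff.comp (hu.fderiv_right hn)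

variable {d : ℕ}

theorem contDiff_coord {n : WithTop ℕ∞} (i : Fin d) : ContDiff ℝ n fun y : E d => y i :=
  (EuclideanSpace.proj (𝕜 := ℝ) i).contDiff

theorem sum_smul_e (y : E d) : ∑ i, y i • e i = y := by
  ext j
  simp [e, Pi.single_apply]

theorem periodic_apply_coord {X : Type*} {f : ℝ → X} (hf : Periodic f 1) (i j : Fin d) (y : E d) :
    f ((y + e i) j) = f (y j) := by
  rcases eq_or_ne j i with rfl | h
  · simpa [e] using hf (y j)
  · simp [e, h]

theorem CellPeriodic.gradient {u : E d → ℝ} (hu : CellPeriodic u) :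
    CellPeriodic (gradient u) := fun i y => by
  have hshift : (fun z => u (z + e i)) = u := funext (hu i)
  unfold _root_.gradient
  rw [← fderiv_comp_add_right, hshift]

theorem CellPeriodic.apply_sub_sum {X : Type*} {f : E d → X} (hf : CellPeriodic f) (n : Fin d → ℤ)
    (s : Finset (Fin d)) (x : E d) : f (x - ∑ i ∈ s, n i • e i) = f x := by
  classical
  induction s using Finset.induction_on generalizing x with
  | empty => simp
  | insert i s his ih =>
    rw [Finset.sum_insert his, ← sub_sub, ih]
    exact (hf i).sub_zsmul_eq (n i)

theorem CellPeriodic.exists_mem_unitCell {X : Type*} {f : E d → X} (hf : CellPeriodic f)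
    (x : E d) : ∃ z ∈ unitCell d, f z = f x := by
  refine ⟨x - ∑ i, ⌊x i⌋ • e i, fun j => ?_, hf.apply_sub_sum _ _ _⟩
  have hfract : (x - ∑ i, ⌊x i⌋ • e i) j = Int.fract (x j) := by
    simp [e, Pi.single_apply]
  rw [hfract]
  exact ⟨Int.fract_nonneg _, Int.fract_lt_one _⟩

theorem isCompact_closure_unitCell (d : ℕ) : IsCompact (closure (unitCell d)) := by
  have hK : IsCompact (WithLp.toLp 2 '' Icc (0 : Fin d → ℝ) 1 : Set (E d)) :=
    isCompact_Icc.image (PiLp.continuous_toLp 2 _)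
  exact hK.closure_of_subset fun y hy =>
    ⟨WithLp.ofLp y, ⟨fun i => (hy i).1, fun i => (hy i).2.le⟩, rfl⟩

theorem integrableOn_unitCell {f : E d → ℝ} (hf : Continuous f) : IntegrableOn f (unitCell d) :=
  (hf.continuousOn.integrableOn_compact (isCompact_closure_unitCell d)).mono_set subset_closure

theorem setIntegral_unitCell (f : E d → ℝ) :
    ∫ y in unitCell d, f y = ∫ z in Icc (0 : Fin d → ℝ) 1, f (WithLp.toLp 2 z) := by
  rw [← (PiLp.volume_preserving_toLp (Fin d)).setIntegral_preimage_emb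
    (MeasurableEquiv.toLp 2 (Fin d → ℝ)).measurableEmbedding f (unitCell d)]
  refine setIntegral_congr_set ?_
  have hpre : (WithLp.toLp 2 ⁻¹' unitCell d : Set (Fin d → ℝ)) =
      Set.pi univ fun i => Ico ((0 : Fin d → ℝ) i) ((1 : Fin d → ℝ) i) := by
    ext z; simp [unitCell]
  rw [hpre]
  exact Measure.univ_pi_Ico_ae_eq_Icc

theorem integral_prod_unitCell (f : Fin d → ℝ → ℝ) :
    ∫ y in unitCell d, ∏ i, f i (y i) = ∏ i, ∫ t in (0 : ℝ)..1, f i t := by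
  have hIcc : Icc (0 : Fin d → ℝ) 1 = Set.pi univ fun _ => Icc (0 : ℝ) 1 := by
    rw [pi_univ_Icc]; rfl
  rw [setIntegral_unitCell, hIcc, volume_pi, Measure.restrict_pi_pi, integral_fintype_prod_eq_prod]
  refine Finset.prod_congr rfl fun i _ => ?_
  rw [intervalIntegral.integral_of_le zero_le_one, integral_Icc_eq_integral_Ioc]

theorem integral_divergence_eq_zero {F : E d → E d} (hF : ContDiff ℝ 1 F)
    (hper : CellPeriodic F) : ∫ y in unitCell d, divergence F y = 0 := by
  rcases d with _ | n
  · simp [divergence]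
  have hFi : ∀ i, ContDiff ℝ 1 fun z => F z i := contDiff_euclidean.1 hF
  let ι : (Fin (n + 1) → ℝ) →L[ℝ] E (n + 1) :=
    (PiLp.continuousLinearEquiv 2 ℝ fun _ : Fin (n + 1) => ℝ).symm
  have hint : IntegrableOn (fun z => ∑ i, (fderiv ℝ (fun y => F y i) (ι z)).comp ι
      (Pi.single i 1)) (Icc 0 1) := by
    refine Continuous.integrableOn_Icc (continuous_finsetSum _ fun i _ => ?_)
    exact (((hFi i).continuous_fderiv one_ne_zero).comp ι.continuous).clm_apply continuous_const
  rw [setIntegral_unitCell]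
  refine (integral_divergence_of_hasFDerivAt_off_countable' (0 : Fin (n + 1) → ℝ) 1
    zero_le_one (fun i z => F (ι z) i) (fun i z => (fderiv ℝ (fun y => F y i) (ι z)).comp ι)
    ∅ countable_empty (fun i => ((hFi i).continuous.comp ι.continuous).continuousOn)
    (fun z _ i => (((hFi i).differentiable one_ne_zero (ι z)).hasFDerivAt).comp z
      ι.hasFDerivAt) hint).trans ?_
  refine Finset.sum_eq_zero fun i _ => sub_eq_zero.2 <|
    integral_congr_ae (Eventually.of_forall fun x => ?_)
  have hface : ι (i.insertNth ((1 : Fin (n + 1) → ℝ) i) x) =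
      ι (i.insertNth ((0 : Fin (n + 1) → ℝ) i) x) + e i := by
    ext j
    refine Fin.succAboveCases i ?_ (fun j => ?_) j <;> simp [ι, e]
  simp only [hface, hper i _]

theorem divergence_smul {ψ : E d → ℝ} {F : E d → E d} {y : E d} (hψ : DifferentiableAt ℝ ψ y)
    (hF : DifferentiableAt ℝ F y) :
    divergence (fun z => ψ z • F z) y = ψ y * divergence F y + fderiv ℝ ψ y (F y) := by
  have hFi : ∀ i, DifferentiableAt ℝ (fun z => F z i) y := differentiableAt_euclidean.1 hF
  have hcoord : ∀ i, fderiv ℝ (fun z => (ψ z • F z) i) y (e i) =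
      ψ y * fderiv ℝ (fun z => F z i) y (e i) + F y i * fderiv ℝ ψ y (e i) := fun i => by
    simp only [PiLp.smul_apply, smul_eq_mul, fderiv_fun_mul hψ (hFi i)]
    simp
  conv_rhs => rw [← sum_smul_e (F y)]
  simp only [divergence, hcoord, map_sum, map_smul, Finset.mul_sum, Finset.sum_add_distrib,
    smul_eq_mul]

theorem divergence_eq_zero_of_forall_line {F : E d → E d} {y : E d} (hF : DifferentiableAt ℝ F y)
    (hline : ∀ (i : Fin d) (t : ℝ), F (y + t • e i) i = F y i) : divergence F y = 0 :=
  Finset.sum_eq_zero fun i _ => by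
    rw [← (differentiableAt_euclidean.1 hF i).lineDeriv_eq_fderiv, lineDeriv,
      funext (hline i), deriv_const]

theorem integral_fderiv_apply_eq_zero {ψ : E d → ℝ} {F : E d → E d} (hψ : ContDiff ℝ 1 ψ)
    (hψp : CellPeriodic ψ) (hF : ContDiff ℝ 1 F) (hFp : CellPeriodic F)
    (hdiv : ∀ y, divergence F y = 0) : ∫ y in unitCell d, fderiv ℝ ψ y (F y) = 0 := by
  have hper : CellPeriodic (ψ • F) := fun i y => by simp only [Pi.smul_apply', hψp i y, hFp i y]
  rw [← integral_divergence_eq_zero (hψ.smul hF) hper]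
  refine integral_congr_ae (Eventually.of_forall fun y => ?_)
  have := divergence_smul (hψ.differentiable one_ne_zero y) (hF.differentiable one_ne_zero y)
  rw [hdiv, mul_zero, zero_add] at this
  exact this.symm

/-! ### Uniqueness of the effective Hamiltonian -/

/-- The cell problem for functions `w` and `m` with just enough regularity to test the transport
equation against periodic `C¹` functions; uniqueness of `h` holds in this class, which also
contains the solutions built from one-dimensional ones. -/
structure IsClassicalSolution (v : E d → ℝ) (Λ : E d) (w m : E d → ℝ) (h : ℝ) : Prop where
  contDiff_w : ContDiff ℝ 1 w
  periodic_w : CellPeriodic w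
  continuous_m : Continuous m
  periodic_m : CellPeriodic m
  m_pos : ∀ y, 0 < m y
  contDiff_flux : ContDiff ℝ 1 fun z => m z • (Λ + gradient w z)
  hamiltonJacobi : ∀ y, ‖Λ + gradient w y‖ ^ 2 / 2 + v y = Real.log (m y) + h
  transport : ∀ y, divergence (fun z => m z • (Λ + gradient w z)) y = 0
  mass : ∫ y in unitCell d, m y = 1

theorem IsCellSolution.isClassicalSolution {α : ℝ≥0} {v : E d → ℝ} {Λ : E d} {w m : E d → ℝ}
    {h : ℝ} (hs : IsCellSolution α v Λ w m h) : IsClassicalSolution v Λ w m h where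
  contDiff_w := hs.w_holder.2.1.of_le one_le_two
  periodic_w := hs.w_holder.1
  continuous_m := hs.m_holder.2.1.continuous
  periodic_m := hs.m_holder.1
  m_pos := hs.m_pos
  contDiff_flux := hs.m_holder.2.1.smul
    (contDiff_const.add (contDiff_gradient hs.w_holder.2.1 one_add_one_eq_two.le))
  hamiltonJacobi := hs.hamiltonJacobi
  transport := fun y => neg_eq_zero.1 (hs.transport y)
  mass := hs.mass

theorem exp_half_norm_sq_tangent_le {F : Type*} [NormedAddCommGroup F] [InnerProductSpace ℝ F]
    (a b : F) (r : ℝ) :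
    Real.exp (‖a‖ ^ 2 / 2 + r) * (1 + inner ℝ (b - a) a) ≤ Real.exp (‖b‖ ^ 2 / 2 + r) := by
  have hsq : inner ℝ (b - a) a ≤ ‖b‖ ^ 2 / 2 - ‖a‖ ^ 2 / 2 := by
    have hexpand := norm_sub_sq_real b a
    rw [inner_sub_left, real_inner_self_eq_norm_sq]
    linarith [sq_nonneg ‖b - a‖]
  calc Real.exp (‖a‖ ^ 2 / 2 + r) * (1 + inner ℝ (b - a) a)
      ≤ Real.exp (‖a‖ ^ 2 / 2 + r) * Real.exp (‖b‖ ^ 2 / 2 - ‖a‖ ^ 2 / 2) := by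
        gcongr
        linarith [Real.add_one_le_exp (‖b‖ ^ 2 / 2 - ‖a‖ ^ 2 / 2)]
    _ = Real.exp (‖b‖ ^ 2 / 2 + r) := by rw [← Real.exp_add]; ring_nf

namespace IsClassicalSolution

variable {v : E d → ℝ} {Λ : E d} {w m w₁ m₁ w₂ m₂ : E d → ℝ} {h h₁ h₂ : ℝ}

theorem exp_mul (hs : IsClassicalSolution v Λ w m h) (y : E d) :
    Real.exp h * m y = Real.exp (‖Λ + gradient w y‖ ^ 2 / 2 + v y) := by
  rw [hs.hamiltonJacobi, Real.exp_add, Real.exp_log (hs.m_pos y), mul_comm]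

theorem exp_eq_integral (hs : IsClassicalSolution v Λ w m h) :
    Real.exp h = ∫ y in unitCell d, Real.exp (‖Λ + gradient w y‖ ^ 2 / 2 + v y) := by
  simp only [← hs.exp_mul, integral_const_mul, hs.mass, mul_one]

theorem exp_mul_add_fderiv_le (hs : IsClassicalSolution v Λ w m h) {u : E d → ℝ}
    (hu : Differentiable ℝ u) (y : E d) :
    Real.exp h * (m y + fderiv ℝ (u - w) y (m y • (Λ + gradient w y))) ≤
      Real.exp (‖Λ + gradient u y‖ ^ 2 / 2 + v y) := by
  have hderiv : fderiv ℝ (u - w) y (Λ + gradient w y) =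
      inner ℝ ((Λ + gradient u y) - (Λ + gradient w y)) (Λ + gradient w y) := by
    rw [fderiv_sub (hu y) (hs.contDiff_w.differentiable one_ne_zero y), add_sub_add_left_eq_sub,
      inner_sub_left, inner_gradient_left, inner_gradient_left, sub_apply]
  calc _ = Real.exp h * m y * (1 + fderiv ℝ (u - w) y (Λ + gradient w y)) := by
        rw [map_smul, smul_eq_mul]; ring
    _ ≤ _ := by
        rw [hs.exp_mul, hderiv]
        exact exp_half_norm_sq_tangent_le _ _ _

theorem exp_le_integral (hs : IsClassicalSolution v Λ w m h) (hv : Continuous v) {u : E d → ℝ}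
    (hu : ContDiff ℝ 1 u) (hup : CellPeriodic u) :
    Real.exp h ≤ ∫ y in unitCell d, Real.exp (‖Λ + gradient u y‖ ^ 2 / 2 + v y) := by
  have hψ : ContDiff ℝ 1 (u - w) := hu.sub hs.contDiff_w
  have hweak : ∫ y in unitCell d, fderiv ℝ (u - w) y (m y • (Λ + gradient w y)) = 0 :=
    integral_fderiv_apply_eq_zero hψ
      (fun i y => by simp only [Pi.sub_apply, hup i y, hs.periodic_w i y]) hs.contDiff_flux
      (fun i y => by simp only [hs.periodic_m i y, hs.periodic_w.gradient i y]) hs.transport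
  have hm := integrableOn_unitCell hs.continuous_m
  have hfderiv := integrableOn_unitCell
    ((hψ.continuous_fderiv one_ne_zero).clm_apply hs.contDiff_flux.continuous)
  have hgrad : Continuous (gradient u) := (contDiff_gradient (n := 0) hu (by simp)).continuous
  calc Real.exp h
      = ∫ y in unitCell d,
          Real.exp h * (m y + fderiv ℝ (u - w) y (m y • (Λ + gradient w y))) := by
        rw [integral_const_mul, integral_add hm hfderiv, hweak, hs.mass, add_zero, mul_one]
    _ ≤ _ := integral_mono ((hm.add hfderiv).const_mul _)
        (integrableOn_unitCell (by fun_prop))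
        (hs.exp_mul_add_fderiv_le (hu.differentiable one_ne_zero))

theorem le (hs₁ : IsClassicalSolution v Λ w₁ m₁ h₁) (hs₂ : IsClassicalSolution v Λ w₂ m₂ h₂)
    (hv : Continuous v) : h₁ ≤ h₂ := by
  rw [← Real.exp_le_exp, hs₂.exp_eq_integral]
  exact hs₁.exp_le_integral hv hs₂.contDiff_w hs₂.periodic_w

theorem unique (hs₁ : IsClassicalSolution v Λ w₁ m₁ h₁) (hs₂ : IsClassicalSolution v Λ w₂ m₂ h₂)
    (hv : Continuous v) : h₁ = h₂ :=
  (hs₁.le hs₂ hv).antisymm (hs₂.le hs₁ hv)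

end IsClassicalSolution

/-! ### Sums of functions of one coordinate -/

theorem hasFDerivAt_sum_coord {f f' : Fin d → ℝ → ℝ} (hf : ∀ i t, HasDerivAt (f i) (f' i t) t)
    (y : E d) : HasFDerivAt (fun y : E d => ∑ i, f i (y i))
      (∑ i, f' i (y i) • (EuclideanSpace.proj i : E d →L[ℝ] ℝ)) y :=
  HasFDerivAt.fun_sum fun i _ =>
    (hf i (y i)).comp_hasFDerivAt y (EuclideanSpace.proj (𝕜 := ℝ) i).hasFDerivAt

theorem gradient_sum_coord {f f' : Fin d → ℝ → ℝ} (hf : ∀ i t, HasDerivAt (f i) (f' i t) t)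
    (y : E d) : gradient (fun y : E d => ∑ i, f i (y i)) y = WithLp.toLp 2 fun i => f' i (y i) := by
  refine HasGradientAt.gradient (hasGradientAt_iff_hasFDerivAt.2 ?_)
  refine (hasFDerivAt_sum_coord hf y).congr_fderiv ?_
  ext z
  simp [PiLp.inner_apply, mul_comm]

theorem secondPartial_const_add_sum_coord {f f' f'' : Fin d → ℝ → ℝ}
    (hf : ∀ i t, HasDerivAt (f i) (f' i t) t) (hf' : ∀ i t, HasDerivAt (f' i) (f'' i t) t)
    (a : ℝ) (y : E d) (j l : Fin d) :
    secondPartial (fun y : E d => a + ∑ i, f i (y i)) y j l = if j = l then f'' j (y j) else 0 := by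
  let π : Fin d → E d →L[ℝ] ℝ := fun i => EuclideanSpace.proj i
  have hfirst : fderiv ℝ (fun y : E d => a + ∑ i, f i (y i)) = fun y => ∑ i, f' i (y i) • π i :=
    funext fun y => ((hasFDerivAt_sum_coord hf y).const_add a).fderiv
  have hsecond : HasFDerivAt (fun y : E d => ∑ i, f' i (y i) • π i)
      (∑ i, (f'' i (y i) • π i).smulRight (π i)) y :=
    HasFDerivAt.fun_sum fun i _ =>
      ((hf' i (y i)).comp_hasFDerivAt y (π i).hasFDerivAt).smul_const (π i)
  rw [secondPartial, iteratedFDeriv_two_apply, hfirst, hsecond.fderiv]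
  rcases eq_or_ne j l with rfl | hjl
  · simp [π, e]
  · simp [π, e, hjl]

theorem mul_norm_sq_le_sum_secondPartial {f f' f'' : Fin d → ℝ → ℝ}
    (hf : ∀ i t, HasDerivAt (f i) (f' i t) t) (hf' : ∀ i t, HasDerivAt (f' i) (f'' i t) t)
    {C : ℝ} (hC : ∀ i t, C ≤ f'' i t) (a : ℝ) (y ξ : E d) :
    C * ‖ξ‖ ^ 2 ≤
      ∑ j, ∑ l, ξ j * secondPartial (fun y : E d => a + ∑ i, f i (y i)) y j l * ξ l := by
  simp only [secondPartial_const_add_sum_coord hf hf', mul_ite, ite_mul, mul_zero, zero_mul,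
    Finset.sum_ite_eq, Finset.mem_univ, if_true]
  rw [EuclideanSpace.real_norm_sq_eq, Finset.mul_sum]
  refine Finset.sum_le_sum fun i _ => ?_
  calc C * ξ i ^ 2 ≤ f'' i (y i) * ξ i ^ 2 := by gcongr; exact hC i (y i)
    _ = ξ i * f'' i (y i) * ξ i := by ring

/-! ### Separable potentials -/

theorem contDiff_toLp_coord {p : Fin d → ℝ → ℝ} {n : WithTop ℕ∞} (hp : ∀ i, ContDiff ℝ n (p i)) :
    ContDiff ℝ n fun y : E d => (WithLp.toLp 2 fun i => p i (y i) : E d) :=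
  contDiff_euclidean.2 fun i => (hp i).comp (contDiff_coord i)

theorem contDiff_prod_coord {μ : Fin d → ℝ → ℝ} {n : WithTop ℕ∞} (hμ : ∀ i, ContDiff ℝ n (μ i)) :
    ContDiff ℝ n fun y : E d => ∏ i, μ i (y i) :=
  contDiff_prod fun i _ => (hμ i).comp (contDiff_coord i)

theorem divergence_prod_smul_eq_zero {p μ : Fin d → ℝ → ℝ} {c : Fin d → ℝ}
    (hp : ∀ i, ContDiff ℝ 1 (p i)) (hμ : ∀ i, ContDiff ℝ 1 (μ i))
    (hflux : ∀ i t, μ i t * p i t = c i) (y : E d) :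
    divergence (fun z => (∏ i, μ i (z i)) • (WithLp.toLp 2 fun i => p i (z i) : E d)) y = 0 := by
  have hcomp : ∀ (i : Fin d) (z : E d),
      (∏ j, μ j (z j)) * p i (z i) = c i * ∏ j ∈ Finset.univ.erase i, μ j (z j) := fun i z => by
    rw [← Finset.mul_prod_erase _ _ (Finset.mem_univ i), ← hflux i (z i), mul_right_comm]
  refine divergence_eq_zero_of_forall_line
    (((contDiff_prod_coord hμ).smul (contDiff_toLp_coord hp)).differentiable one_ne_zero y)
    fun i t => ?_
  simp only [PiLp.smul_apply, smul_eq_mul, hcomp]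
  congr 1
  refine Finset.prod_congr rfl fun j hj => ?_
  simp [e, Finset.ne_of_mem_erase hj]

theorem exists_isClassicalSolution_of_sum {v p μ : Fin d → ℝ → ℝ} {c h : Fin d → ℝ} {Λ : E d}
    (hs : ∀ i, IsMomentumSolution (v i) (Λ i) (p i) (μ i) (c i) (h i)) (a : ℝ) :
    ∃ w m, IsClassicalSolution (fun y => a + ∑ i, v i (y i)) Λ w m (a + ∑ i, h i) := by
  choose φ hφ hφper hφderiv using fun i =>
    exists_periodic_primitive (hs i).contDiff_momentum.continuous (hs i).periodic_momentum
  simp only [(hs _).mean_momentum] at hφderiv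
  have hgrad : ∀ y : E d, Λ + gradient (fun y : E d => ∑ i, φ i (y i)) y =
      WithLp.toLp 2 fun i => p i (y i) := fun y => by
    rw [gradient_sum_coord hφderiv]
    ext i
    simp
  have hp := contDiff_toLp_coord fun i => (hs i).contDiff_momentum
  have hμ := contDiff_prod_coord fun i => (hs i).contDiff_density
  exact ⟨fun y => ∑ i, φ i (y i), fun y => ∏ i, μ i (y i),
    { contDiff_w := ContDiff.sum fun i _ => (hφ i).comp (contDiff_coord i)
      periodic_w := fun i y =>
        Finset.sum_congr rfl fun j _ => periodic_apply_coord (hφper j) i j y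
      continuous_m := hμ.continuous
      periodic_m := fun i y =>
        Finset.prod_congr rfl fun j _ => periodic_apply_coord (hs j).periodic_density i j y
      m_pos := fun y => Finset.prod_pos fun i _ => (hs i).density_pos _
      contDiff_flux := by
        simp only [hgrad]
        exact hμ.smul hp
      hamiltonJacobi := fun y => by
        rw [hgrad, EuclideanSpace.real_norm_sq_eq,
          Real.log_prod fun i _ => ((hs i).density_pos _).ne', Finset.sum_div, add_left_comm,
          ← Finset.sum_add_distrib, add_left_comm, ← Finset.sum_add_distrib]
        simp only [(hs _).hamiltonJacobi]
      transport := by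
        simpa only [hgrad] using divergence_prod_smul_eq_zero
          (fun i => (hs i).contDiff_momentum) (fun i => (hs i).contDiff_density)
          fun i => (hs i).flux
      mass := by
        rw [integral_prod_unitCell]
        exact Finset.prod_eq_one fun i _ => (hs i).mass }⟩

/-- The restriction of `v` to the `i`-th coordinate axis, normalized to vanish at the origin; these
are the one-dimensional potentials of which a separable `v` is built. -/
def axisSlice (v : E d → ℝ) (i : Fin d) (t : ℝ) : ℝ := v (t • e i) - v 0

/-- Separability of `v` into functions of one coordinate, in the canonical form where these are the
`axisSlice`s; they inherit regularity, periodicity and oscillation from `v`. -/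
def AxisSeparable (v : E d → ℝ) : Prop := ∀ y, v y = v 0 + ∑ i, axisSlice v i (y i)

theorem contDiff_axisSlice {v : E d → ℝ} {n : WithTop ℕ∞} (hv : ContDiff ℝ n v) (i : Fin d) :
    ContDiff ℝ n (axisSlice v i) :=
  (hv.comp (contDiff_id.smul contDiff_const)).sub contDiff_const

theorem periodic_axisSlice {v : E d → ℝ} (hv : CellPeriodic v) (i : Fin d) :
    Periodic (axisSlice v i) 1 := fun t => by
  rw [axisSlice, add_smul, one_smul, hv i, axisSlice]

theorem axisSeparable_of_sum {v : E d → ℝ} {W : Fin d → ℝ → ℝ}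
    (hv : ∀ y, v y = ∑ i, W i (y i)) : AxisSeparable v := fun y => by
  have hslice : ∀ i, axisSlice v i (y i) = W i (y i) - W i 0 := fun i => by
    rw [axisSlice, hv, hv, ← Finset.sum_sub_distrib, Finset.sum_eq_single i]
    · simp [e]
    · intro j _ hj
      simp [e, hj]
    · simp
  simp only [hslice, hv, Finset.sum_sub_distrib, PiLp.zero_apply, add_sub_cancel]

theorem axisSeparable_of_le_one {v : E d → ℝ} (hd : d ≤ 1) : AxisSeparable v := fun y => by
  interval_cases d
  · simp [Subsingleton.elim y 0]
  · have hy : y 0 • e 0 = y := by simpa using sum_smul_e y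
    simp [axisSlice, hy]

theorem axisSeparable_of_isSeparable {V : E d → E d → ℝ} (hsep : 1 < d → IsSeparable V) (x : E d) :
    AxisSeparable (V x) := by
  rcases le_or_gt d 1 with hd | hd
  · exact axisSeparable_of_le_one hd
  · obtain ⟨W, -, -, hW⟩ := hsep hd
    exact axisSeparable_of_sum (hW x)

theorem IsClassicalSolution.eq_add_sum_effectiveHamiltonian {v : E d → ℝ} {Λ : E d}
    {w m : E d → ℝ} {h : ℝ} (hs : IsClassicalSolution v Λ w m h) (hv : ContDiff ℝ 1 v)
    (hper : CellPeriodic v) (hsep : AxisSeparable v) :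
    h = v 0 + ∑ i, effectiveHamiltonian (contDiff_axisSlice hv i).continuous (Λ i) := by
  obtain ⟨w', m', hs'⟩ := exists_isClassicalSolution_of_sum (Λ := Λ) (fun i =>
    isMomentumSolution_effectiveHamiltonian (contDiff_axisSlice hv i) (periodic_axisSlice hper i)
      (Λ i)) (v 0)
  rw [← funext hsep] at hs'
  exact hs.unique hs' hv.continuous

theorem IsPotential.contDiff {V : E d → E d → ℝ} (hV : IsPotential V) (x : E d) :
    ContDiff ℝ ∞ (V x) :=
  hV.smooth.comp (contDiff_const.prodMk contDiff_id)

theorem IsPotential.exists_oscillation_le {V : E d → E d → ℝ} (hV : IsPotential V) :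
    ∃ R, ∀ x y z, V x y - V x z ≤ R := by
  have hK := isCompact_closure_unitCell d
  obtain ⟨B, hB⟩ := (hK.prod hK).exists_bound_of_continuousOn hV.smooth.continuous.continuousOn
  have hbound : ∀ x y, |V x y| ≤ B := fun x y => by
    obtain ⟨x', hx', hxx'⟩ := hV.periodic_x.exists_mem_unitCell x
    obtain ⟨y', hy', hyy'⟩ := (hV.periodic_y x).exists_mem_unitCell y
    rw [← hyy', ← hxx']
    exact hB (x', y') ⟨subset_closure hx', subset_closure hy'⟩
  exact ⟨B + B, fun x y z => by linarith [abs_le.1 (hbound x y), abs_le.1 (hbound x z)]⟩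

end

end CellProblem

open CellProblem in
theorem mainTheorem5_general {X : Type*} {d : ℕ} {V : X → E d → ℝ}
    (hV : ∀ x, ContDiff ℝ 1 (V x)) (hper : ∀ x, CellPeriodic (V x))
    (hsep : ∀ x, AxisSeparable (V x)) {R : ℝ} (hR : ∀ x y z, V x y - V x z ≤ R)
    {H : X → E d → ℝ} (hsol : ∀ x Λ, ∃ w m, IsClassicalSolution (V x) Λ w m (H x Λ)) :
    (∀ x, ContDiff ℝ 2 (H x)) ∧ ∃ C : ℝ, 0 < C ∧ ∀ x (Λ ξ : E d),
      C * ‖ξ‖ ^ 2 ≤ ∑ j, ∑ l, ξ j * secondPartial (H x) Λ j l * ξ l := by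
  have hslice x i : Continuous (axisSlice (V x) i) := (contDiff_axisSlice (hV x) i).continuous
  have hH x : H x = fun Λ => V x 0 + ∑ i, effectiveHamiltonian (hslice x i) (Λ i) :=
    funext fun Λ => by
      obtain ⟨w, m, hs⟩ := hsol x Λ
      exact hs.eq_add_sum_effectiveHamiltonian (hV x) (hper x) (hsep x)
  refine ⟨fun x => ?_, Real.exp (-R) ^ 2, by positivity, fun x Λ ξ => ?_⟩
  · rw [hH]
    exact contDiff_const.add (ContDiff.sum fun i _ =>
      (contDiff_effectiveHamiltonian (hslice x i)).comp (contDiff_coord i))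
  · have hflux i L : Real.exp (-R) ^ 2 ≤ fluxDeriv (hslice x i) L :=
      exp_neg_sq_le_fluxDeriv (hslice x i) (fun s t => by simpa [axisSlice] using hR x _ _) L
    rw [hH]
    exact mul_norm_sq_le_sum_secondPartial (fun i => hasDerivAt_effectiveHamiltonian (hslice x i))
      (fun i => hasDerivAt_flux (hslice x i)) hflux (V x 0) Λ ξ

theorem mainTheorem5 {d : ℕ} (V : CellProblem.E d → CellProblem.E d → ℝ)
    (hV : CellProblem.IsPotential V)
    (hsep : 1 < d → CellProblem.IsSeparable V)
    (α : ℝ≥0) (hα₀ : 0 < α) (hα₁ : α < 1)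
    (w m : CellProblem.E d → CellProblem.E d → CellProblem.E d → ℝ)
    (H : CellProblem.E d → CellProblem.E d → ℝ)
    (hsol : ∀ x Λ, CellProblem.IsCellSolution α (V x) Λ (w x Λ) (m x Λ) (H x Λ)) :
    (∀ x, ContDiff ℝ 2 (H x)) ∧
    ∃ C : ℝ, 0 < C ∧ ∀ x Λ ξ : CellProblem.E d,
      C * ‖ξ‖ ^ 2 ≤
        ∑ j : Fin d, ∑ l : Fin d, ξ j * CellProblem.secondPartial (H x) Λ j l * ξ l := by
  obtain ⟨R, hR⟩ := hV.exists_oscillation_le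
  exact mainTheorem5_general (fun x => (hV.contDiff x).of_le (by simp)) hV.periodic_y
    (CellProblem.axisSeparable_of_isSeparable hsep) hR
    fun x Λ => ⟨w x Λ, m x Λ, (hsol x Λ).isClassicalSolution⟩
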